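/- Let $R$ be a commutative Noetherian local ring with maximal ideal $\mathfrak m$, and let $M$ and $N$ be nonzero finitely generated $R$-modules. For a nonzero finitely generated $R$-module $X$, $\operatorname{depth}X$ denotes the supremum of the lengths of $X$-regular sequences in $\mathfrak m$, and $\operatorname{pd}$ denotes projective dimension. The module $N$ is called strongly-rigid if, for every finitely generated $R$-module $X$, $\operatorname{Tor}_i^R(N,X)=0$ for some $i\ge 1$ implies $\operatorname{pd}X<\infty$. It is called a rigid-test module if, for every finitely generated $R$-module $X$ and every $i\ge 1$, $\operatorname{Tor}_i^R(N,X)=0$ implies both $\operatorname{Tor}_{i+1}^R(N,X)=0$ and $\operatorname{pd}X<\infty$. Let $n\ge 0$ be an integer with $\operatorname{Ext}^n_R(M,N)=0$, and suppose that at least one of the following holds: (i) $N$ is strongly-rigid and $n\ge\operatorname{depth}R$; (ii) $N$ is a rigid-test module and $n\ge\operatorname{depth}N$. Then $$\operatorname{pd}M=\sup\{i\in\mathbb Z:\operatorname{Ext}^i_R(M,N)\ne 0\}\le n-1.$$ -/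

import Mathlib

open CategoryTheory

universe u

/-- The depth of a module `M` over a local ring `R`: the supremum of the lengths of the `M`-regular
sequences in the maximal ideal. The condition `M ≠ (r₁, …, rₙ)M` in the definition of a regular
sequence is automatic (Nakayama) for a nonzero finitely generated module `M` and elements `rᵢ` of
the maximal ideal; leaving it out gives the usual convention `depth 0 = ∞`. -/
noncomputable def moduleDepth (R : Type u) [CommRing R] [IsLocalRing R]
    (M : Type u) [AddCommGroup M] [Module R M] : ℕ∞ :=
  ⨆ rs : {rs : List R // (∀ r ∈ rs, r ∈ IsLocalRing.maximalIdeal R) ∧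
    RingTheory.Sequence.IsWeaklyRegular M rs}, (rs.1.length : ℕ∞)

/-- The projective dimension of an `R`-module, with value `⊥` exactly for the zero module and
value `⊤` if there is no finite projective resolution. -/
noncomputable abbrev projDim (R : Type u) [CommRing R]
    (M : Type u) [AddCommGroup M] [Module R M] : WithBot ℕ∞ :=
  projectiveDimension (ModuleCat.of R M)

/-- `Tor_n^R(M, X) = 0`. -/
def TorVanishes (R : Type u) [CommRing R] (n : ℕ) (M X : Type u)
    [AddCommGroup M] [Module R M] [AddCommGroup X] [Module R X] : Prop :=
  Limits.IsZero (((Tor (ModuleCat.{u} R) n).obj (ModuleCat.of R M)).obj (ModuleCat.of R X))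

/-- `M` is strongly-rigid: for every finitely generated module `X`, if `Tor_n(M, X) = 0` for some
`n ≥ 1`, then `X` has finite projective dimension. -/
def IsStronglyRigid (R : Type u) [CommRing R] (M : Type u) [AddCommGroup M] [Module R M] : Prop :=
  ∀ (X : Type u) [AddCommGroup X] [Module R X] [Module.Finite R X] (n : ℕ), 1 ≤ n →
    TorVanishes R n M X → projDim R X < ⊤

/-- `M` is a rigid-test module: for every finitely generated module `X`, if `Tor_n(M, X) = 0` for
some `n ≥ 1`, then `Tor_{n+1}(M, X) = 0` and `X` has finite projective dimension. -/
def IsRigidTest (R : Type u) [CommRing R] (M : Type u) [AddCommGroup M] [Module R M] : Prop :=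
  ∀ (X : Type u) [AddCommGroup X] [Module R X] [Module.Finite R X] (n : ℕ), 1 ≤ n →
    TorVanishes R n M X → TorVanishes R (n + 1) M X ∧ projDim R X < ⊤

/-- The `R`-module `Ext^n_R(M, N)`, as a type. -/
abbrev ExtMod (R : Type u) [CommRing R] (n : ℕ) (M N : Type u)
    [AddCommGroup M] [Module R M] [AddCommGroup N] [Module R N] : Type u :=
  Abelian.Ext.{u} (ModuleCat.of R M) (ModuleCat.of R N) n

/-- `sup {i : Ext^i_R(M, N) ≠ 0}`, computed in `{-∞} ∪ ℕ ∪ {∞}` (so the empty supremum is `-∞`). -/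
noncomputable def supExt (R : Type u) [CommRing R] (M N : Type u)
    [AddCommGroup M] [Module R M] [AddCommGroup N] [Module R N] : WithBot ℕ∞ :=
  sSup {a : WithBot ℕ∞ | ∃ i : ℕ, a = ((i : ℕ∞) : WithBot ℕ∞) ∧ Nontrivial (ExtMod R i M N)}

/-! Let `X` be the `n`-th syzygy of `M`, included in a finite free module `F` (for `n = 0`, `X = M`
and `F = 0`). Vanishing of `Extⁿ(M, N)` says that every map `X → N` extends to `F`, hence factors
through a finite free module. For a finite free presentation `F₁ → F₀ → X → 0` with transpose `T =
coker (F₀* → F₁*)`, this amounts to `Tor₁(N, T) = 0` (`torVanishes_transpose_iff`). Rigidity then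
gives `pd T < ∞`, and a depth bound of Auslander–Buchsbaum type sharpens this to `pd T ≤ n`
(`hasProjectiveDimensionLT_of_moduleDepth_le`).

As `X` is an `n`-th syzygy, `Tor₁(X, T)` shifts to `Tor_{n+1}(M, T) = 0`. The transpose criterion
with `X` in place of `N` puts `id_X` in the image of `X* ⊗ X`, so `X` is projective. Extension of
maps into the nonzero module `N` now forces `X → F` to split by Nakayama
(`exists_retraction_of_forall_extend`), whence `pd M < n`. The same splitting shows that `Ext(M, N)`
is nonzero in degree `pd M`, which identifies the supremum. -/

/-! ### Tor from projective resolutions, and dimension shifting -/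

open Limits MonoidalCategory in
theorem torVanishes_succ_iff_exact {R : Type u} [CommRing R] {N T : Type u} [AddCommGroup N]
    [Module R N] [AddCommGroup T] [Module R T] (P : ProjectiveResolution (ModuleCat.of R T))
    (j : ℕ) :
    TorVanishes R (j + 1) N T ↔
      Function.Exact ((P.complex.d (j + 2) (j + 1)).hom.lTensor N)
        ((P.complex.d (j + 1) j).hom.lTensor N) := by
  unfold TorVanishes
  rw [Tor_obj, (P.isoLeftDerivedObj ((tensoringLeft (ModuleCat.{u} R)).obj (ModuleCat.of R N))
    (j + 1)).isZero_iff]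
  erw [← HomologicalComplex.exactAt_iff_isZero_homology]
  rw [HomologicalComplex.exactAt_iff' _ (j + 2) (j + 1) j (by simp) (by simp),
    ShortComplex.ShortExact.moduleCat_exact_iff_function_exact]
  rfl

/-- The augmentation of a projective resolution, as a morphism of the ambient category. -/
noncomputable def CategoryTheory.ProjectiveResolution.augmentation {C : Type*} [Category C] [Abelian C] {Z : C}
    (Q : ProjectiveResolution Z) : Q.complex.X 0 ⟶ Z := Q.π.f 0

namespace CategoryTheory.ProjectiveResolution

variable {C : Type*} [Category C] [Abelian C] {Z : C} (Q : ProjectiveResolution Z)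

theorem d_comp_augmentation : Q.complex.d 1 0 ≫ Q.augmentation = 0 :=
  Q.complex_d_comp_π_f_zero

instance : Epi Q.augmentation := inferInstanceAs (Epi (Q.π.f 0))

theorem exact_augmentation :
    (ShortComplex.mk _ _ Q.d_comp_augmentation).Exact :=
  ShortComplex.exact_of_g_is_cokernel _ Q.isColimitCokernelCofork

end CategoryTheory.ProjectiveResolution

/-- The chain complex obtained by splicing a projective resolution of `X₁` with a short complex
`X₁ → X₂ → X₃`. -/
noncomputable def spliceComplex {C : Type*} [Category C] [Abelian C]
    (S : ShortComplex C) (Q : ProjectiveResolution S.X₁) : ChainComplex C ℕ :=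
  ChainComplex.augment Q.complex (Q.augmentation ≫ S.f) (by
    rw [← Category.assoc, Q.d_comp_augmentation, Limits.zero_comp])

theorem spliceComplex_d_comp {C : Type*} [Category C] [Abelian C]
    (S : ShortComplex C) (Q : ProjectiveResolution S.X₁) :
    (spliceComplex S Q).d 1 0 ≫ S.g = 0 := by
  change (Q.augmentation ≫ S.f) ≫ S.g = 0
  simp

/-- The projective resolution obtained by splicing a projective resolution of `X₁` with a short
exact sequence `0 → X₁ → X₂ → X₃ → 0` with `X₂` projective. -/
noncomputable def spliceResolution {C : Type*} [Category C] [Abelian C]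
    {S : ShortComplex C} (hS : S.ShortExact) [Projective S.X₂] (Q : ProjectiveResolution S.X₁) :
    ProjectiveResolution S.X₃ where
  complex := spliceComplex S Q
  projective n := by
    cases n with
    | zero => assumption
    | succ n => exact Q.projective n
  π := (ChainComplex.toSingle₀Equiv _ _).symm ⟨S.g, spliceComplex_d_comp S Q⟩
  quasiIso := ⟨fun n => by
    have := hS.mono_f
    have := hS.epi_g
    cases n with
    | zero =>
      rw [ChainComplex.quasiIsoAt₀_iff, ShortComplex.quasiIso_iff_of_zeros']
      · have h : (ShortComplex.mk (Q.augmentation ≫ S.f) S.g (by simp)).Exact := by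
          let φ : ShortComplex.mk (Q.augmentation ≫ S.f) S.g (by simp) ⟶ S :=
            { τ₁ := Q.augmentation
              τ₂ := 𝟙 _
              τ₃ := 𝟙 _ }
          have : Epi φ.τ₁ := inferInstanceAs (Epi Q.augmentation)
          exact (ShortComplex.exact_iff_of_epi_of_isIso_of_mono φ).2 hS.exact
        refine (ShortComplex.exact_and_epi_g_iff_of_iso ?_).2 ⟨h, this⟩
        exact ShortComplex.isoMk (Iso.refl _) (Iso.refl _) (Iso.refl _)
          ((Category.id_comp _).trans (Category.comp_id _).symm)
          ((Category.id_comp _).trans (Eq.trans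
            (ChainComplex.toSingle₀Equiv_symm_apply_f_zero (C := spliceComplex S Q) S.g
              (spliceComplex_d_comp S Q)).symm (Category.comp_id _).symm))
      all_goals rfl
    | succ n =>
      rw [quasiIsoAt_iff_exactAt']
      · rw [HomologicalComplex.exactAt_iff' _ (n + 2) (n + 1) n (by simp) (by simp)]
        cases n with
        | zero =>
          -- Composing with the monomorphism `S.f` leaves the kernel of the augmentation unchanged.
          let φ : ShortComplex.mk _ _ Q.d_comp_augmentation ⟶
            ShortComplex.mk (Q.complex.d 1 0) (Q.augmentation ≫ S.f)
              (by rw [← Category.assoc, Q.d_comp_augmentation, Limits.zero_comp]) :=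
            { τ₁ := 𝟙 _
              τ₂ := 𝟙 _
              τ₃ := S.f }
          exact (ShortComplex.exact_iff_of_epi_of_isIso_of_mono φ).1 Q.exact_augmentation
        | succ n => exact Q.exact_succ n
      · apply ChainComplex.exactAt_succ_single_obj⟩

section

variable {R : Type u} [CommRing R] {N K F T : Type u} [AddCommGroup N] [Module R N]
  [AddCommGroup K] [Module R K] [AddCommGroup F] [Module R F] [AddCommGroup T] [Module R T]

/-- The short complex of `R`-modules attached to a pair of composable maps with exactness. -/
abbrev exactShortComplex {i : K →ₗ[R] F} {f : F →ₗ[R] T} (h : Function.Exact i f) :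
    ShortComplex (ModuleCat.{u} R) :=
  ShortComplex.mk (ModuleCat.ofHom i) (ModuleCat.ofHom f) (by
    ext x; exact h.apply_apply_eq_zero x)

theorem exactShortComplex_shortExact {i : K →ₗ[R] F} {f : F →ₗ[R] T} (h : Function.Exact i f)
    (hi : Function.Injective i) (hf : Function.Surjective f) :
    (exactShortComplex h).ShortExact where
  exact := ModuleCat.shortComplex_exact _ h
  mono_f := (ModuleCat.mono_iff_injective _).2 hi
  epi_g := (ModuleCat.epi_iff_surjective _).2 hf

/-- The spliced resolution of `T` is that of `K` moved up one degree, so both sides unfold to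
exactness at the same spot. -/
theorem torVanishes_succ_succ_iff [Module.Projective R F] {i : K →ₗ[R] F} {f : F →ₗ[R] T}
    (hi : Function.Injective i) (h : Function.Exact i f) (hf : Function.Surjective f) (j : ℕ) :
    TorVanishes R (j + 2) N T ↔ TorVanishes R (j + 1) N K := by
  have : Projective (exactShortComplex h).X₂ := inferInstanceAs (Projective (ModuleCat.of R F))
  let Q : ProjectiveResolution (ModuleCat.of R K) := ProjectiveResolution.of _
  rw [torVanishes_succ_iff_exact Q, torVanishes_succ_iff_exact
    (spliceResolution (exactShortComplex_shortExact h hi hf) Q)]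
  rfl

theorem torVanishes_one_iff [Module.Projective R F] {i : K →ₗ[R] F} {f : F →ₗ[R] T}
    (hi : Function.Injective i) (h : Function.Exact i f) (hf : Function.Surjective f) :
    TorVanishes R 1 N T ↔ Function.Injective (i.lTensor N) := by
  have : Projective (exactShortComplex h).X₂ := inferInstanceAs (Projective (ModuleCat.of R F))
  let Q : ProjectiveResolution (ModuleCat.of R K) := ProjectiveResolution.of _
  have he := lTensor_exact N ((ShortComplex.ShortExact.moduleCat_exact_iff_function_exact _).1
    Q.exact_augmentation) ((ModuleCat.epi_iff_surjective Q.augmentation).1 inferInstance)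
  have hs := LinearMap.lTensor_surjective N
    ((ModuleCat.epi_iff_surjective Q.augmentation).1 inferInstance)
  rw [torVanishes_succ_iff_exact
    (spliceResolution (exactShortComplex_shortExact h hi hf) Q)]
  change Function.Exact ((Q.complex.d 1 0).hom.lTensor N)
    ((i ∘ₗ Q.augmentation.hom).lTensor N) ↔ _
  rw [LinearMap.lTensor_comp]
  constructor
  · intro H
    rw [injective_iff_map_eq_zero]
    intro x hx
    obtain ⟨y, rfl⟩ := hs x
    exact (he y).2 ((H y).1 hx)
  · intro H y
    rw [← he y]
    exact map_eq_zero_iff _ H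

end

/-! ### Symmetry of Tor in low degree -/

section Balance

open TensorProduct

variable {R : Type u} [CommRing R]

theorem lTensor_injective_iff_rTensor_injective {A K F : Type*} [AddCommMonoid A]
    [Module R A] [AddCommMonoid K] [Module R K] [AddCommMonoid F] [Module R F] (i : K →ₗ[R] F) :
    Function.Injective (i.lTensor A) ↔ Function.Injective (i.rTensor A) := by
  have h : i.lTensor A = (TensorProduct.comm R F A).toLinearMap ∘ₗ i.rTensor A ∘ₗ
      (TensorProduct.comm R A K).toLinearMap := by
    ext; simp
  rw [h]
  simp

variable {A B : Type u} [AddCommGroup A] [Module R A] [AddCommGroup B] [Module R B]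

theorem exists_free_cover (R : Type u) [CommRing R] (B : Type u) [AddCommGroup B] [Module R B] :
    ∃ (F : Type u) (_ : AddCommGroup F) (_ : Module R F) (_ : Module.Free R F) (f : F →ₗ[R] B),
      Function.Surjective f :=
  ⟨B →₀ R, inferInstance, inferInstance, inferInstance, Finsupp.linearCombination R id,
    Finsupp.linearCombination_id_surjective R B⟩

/-- A diagram chase on the tensor product of two free presentations. `Tor` is derived in its second
variable only, so the symmetry needs an argument. -/
theorem TorVanishes.symm (h : TorVanishes R 1 A B) : TorVanishes R 1 B A := by
  obtain ⟨F, _, _, _, f, hf⟩ := exists_free_cover R B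
  obtain ⟨F', _, _, _, f', hf'⟩ := exists_free_cover R A
  have hk := f.exact_subtype_ker_map
  have hk' := f'.exact_subtype_ker_map
  rw [torVanishes_one_iff (Submodule.subtype_injective _) hk hf] at h
  rw [torVanishes_one_iff (Submodule.subtype_injective _) hk' hf']
  exact lTensor_injective_of_exact_of_exact_of_rTensor_injective hk hf hk' hf'
    ((lTensor_injective_iff_rTensor_injective _).1 h)
    (Module.Flat.lTensor_preserves_injective_linearMap _ (Submodule.subtype_injective _))

theorem TorVanishes.lTensor_injective {K F : Type u} [AddCommGroup K] [Module R K]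
    [AddCommGroup F] [Module R F] (h : TorVanishes R 1 A B) {i : K →ₗ[R] F} {f : F →ₗ[R] B}
    (hi : Function.Injective i) (hif : Function.Exact i f) (hf : Function.Surjective f) :
    Function.Injective (i.lTensor A) := by
  obtain ⟨F', _, _, _, f', hf'⟩ := exists_free_cover R A
  have hk' := f'.exact_subtype_ker_map
  have h' := h.symm
  rw [torVanishes_one_iff (Submodule.subtype_injective _) hk' hf'] at h'
  exact lTensor_injective_of_exact_of_exact_of_rTensor_injective hk' hf' hif hf
    ((lTensor_injective_iff_rTensor_injective _).1 h')
    (Module.Flat.lTensor_preserves_injective_linearMap _ hi)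

/-- If `Tor₂(A, B) = 0` then `Tor₁(K, B) = 0` for a first syzygy `K` of `A`. -/
theorem TorVanishes.syzygy_left {K F : Type u} [AddCommGroup K] [Module R K]
    [AddCommGroup F] [Module R F] [Module.Projective R F] (h : TorVanishes R 2 A B)
    {i : K →ₗ[R] F} {f : F →ₗ[R] A}
    (hi : Function.Injective i) (hif : Function.Exact i f) (hf : Function.Surjective f) :
    TorVanishes R 1 K B := by
  obtain ⟨G, _, _, _, g, hg⟩ := exists_free_cover R B
  have hk := g.exact_subtype_ker_map
  rw [torVanishes_succ_succ_iff (Submodule.subtype_injective _) hk hg] at h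
  rw [torVanishes_one_iff (Submodule.subtype_injective _) hk hg]
  have h1 := (lTensor_injective_iff_rTensor_injective _).1 (h.symm.lTensor_injective hi hif hf)
  have h2 : Function.Injective ((LinearMap.ker g).subtype.lTensor F) :=
    Module.Flat.lTensor_preserves_injective_linearMap _ (Submodule.subtype_injective _)
  have h3 : (i.rTensor G) ∘ₗ (LinearMap.ker g).subtype.lTensor K =
      (LinearMap.ker g).subtype.lTensor F ∘ₗ i.rTensor (LinearMap.ker g) := by
    rw [LinearMap.rTensor_comp_lTensor, LinearMap.lTensor_comp_rTensor]
  refine Function.Injective.of_comp (f := i.rTensor G) ?_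
  rw [← LinearMap.coe_comp, h3, LinearMap.coe_comp]
  exact h2.comp h1

theorem torVanishes_of_projective [Module.Projective R B] (n : ℕ) :
    TorVanishes R (n + 1) A B := by
  have : Projective (ModuleCat.of R B) := (IsProjective.iff_projective _).1 inferInstance
  exact isZero_Tor_succ_of_projective (ModuleCat.{u} R) _ _ n

theorem torVanishes_of_flat [Module.Flat R A] (n : ℕ) :
    TorVanishes R (n + 1) A B := by
  induction n generalizing B with
  | zero =>
    obtain ⟨G, _, _, _, g, hg⟩ := exists_free_cover R B
    rw [torVanishes_one_iff (Submodule.subtype_injective _) g.exact_subtype_ker_map hg]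
    exact Module.Flat.lTensor_preserves_injective_linearMap _ (Submodule.subtype_injective _)
  | succ n ih =>
    obtain ⟨G, _, _, _, g, hg⟩ := exists_free_cover R B
    rw [torVanishes_succ_succ_iff (Submodule.subtype_injective _) g.exact_subtype_ker_map hg]
    exact ih

end Balance

/-! ### Projective dimension of syzygies -/

section ProjDim

variable {R : Type u} [CommRing R]

theorem hasProjectiveDimensionLT_ker_iff {F T : Type u} [AddCommGroup F] [Module R F]
    [AddCommGroup T] [Module R T] [Module.Projective R F] {f : F →ₗ[R] T}
    (hf : Function.Surjective f) (n : ℕ) :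
    HasProjectiveDimensionLT (ModuleCat.of R (LinearMap.ker f)) (n + 1) ↔
      HasProjectiveDimensionLT (ModuleCat.of R T) (n + 2) :=
  ((LinearMap.shortExact_shortComplexKer hf).hasProjectiveDimensionLT_X₃_iff n
    (inferInstanceAs (Projective (ModuleCat.of R F)))).symm

theorem projective_iff_hasProjectiveDimensionLT {T : Type u} [AddCommGroup T] [Module R T] :
    Module.Projective R T ↔ HasProjectiveDimensionLT (ModuleCat.of R T) 1 := by
  rw [← projective_iff_hasProjectiveDimensionLT_one, ← IsProjective.iff_projective]

theorem exists_finite_free_cover (R : Type u) [CommRing R] (B : Type u) [AddCommGroup B]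
    [Module R B] [Module.Finite R B] :
    ∃ (F : Type u) (_ : AddCommGroup F) (_ : Module R F) (_ : Module.Free R F)
      (_ : Module.Finite R F) (f : F →ₗ[R] B), Function.Surjective f := by
  obtain ⟨n, f, hf⟩ := Module.Finite.exists_fin' R B
  exact ⟨Fin n → R, inferInstance, inferInstance, inferInstance, inferInstance, f, hf⟩

end ProjDim

/-! ### The map `X* ⊗ N → Hom(X, N)` and the transpose -/

section DualTensor

open TensorProduct

variable {R : Type u} [CommRing R] {N X Y : Type u} [AddCommGroup N] [Module R N]
  [AddCommGroup X] [Module R X] [AddCommGroup Y] [Module R Y]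

theorem dualTensorHom_rTensor_dualMap (i : X →ₗ[R] Y) (t : Module.Dual R Y ⊗[R] N) :
    dualTensorHom R X N (i.dualMap.rTensor N t) = dualTensorHom R Y N t ∘ₗ i := by
  induction t with
  | zero => simp
  | tmul φ n => ext; simp
  | add a b ha hb => simp [ha, hb, LinearMap.add_comp]

theorem exists_comp_eq_of_exact {W : Type u} [AddCommGroup W] [Module R W] {d : W →ₗ[R] Y}
    {p : Y →ₗ[R] X} (hdp : Function.Exact d p) (hp : Function.Surjective p) (φ : Y →ₗ[R] N)
    (h : φ ∘ₗ d = 0) : ∃ g : X →ₗ[R] N, g ∘ₗ p = φ := by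
  refine ⟨(LinearMap.ker p).liftQ φ ?_ ∘ₗ (p.quotKerEquivOfSurjective hp).symm.toLinearMap, ?_⟩
  · intro x hx
    obtain ⟨y, rfl⟩ := (hdp x).1 hx
    exact LinearMap.congr_fun h y
  · ext x
    have : (p.quotKerEquivOfSurjective hp).symm (p x) = Submodule.Quotient.mk x := by
      rw [LinearEquiv.symm_apply_eq]; rfl
    simp [this]

theorem mem_range_dualTensorHom_of_factor [Module.Finite R Y] [Module.Projective R Y]
    (i : X →ₗ[R] Y) (h : Y →ₗ[R] N) : h ∘ₗ i ∈ LinearMap.range (dualTensorHom R X N) := by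
  obtain ⟨t, rfl⟩ := (dualTensorHom_bijective (R := R) (M := Y) (N := N)).2 h
  exact ⟨_, dualTensorHom_rTensor_dualMap i t⟩

/-- A preimage of the identity is a finite dual basis, which splits `X` off a finite free module. -/
theorem projective_of_id_mem_range_dualTensorHom
    (h : LinearMap.id ∈ LinearMap.range (dualTensorHom R X X)) : Module.Projective R X := by
  obtain ⟨t, ht⟩ := h
  obtain ⟨s, rfl⟩ := TensorProduct.exists_finset t
  let a : X →ₗ[R] (s → R) := LinearMap.pi fun p => p.1.1
  let b : (s → R) →ₗ[R] X := Fintype.linearCombination R fun p => p.1.2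
  refine Module.Projective.of_split a b ?_
  ext x
  have := congrArg (fun g : X →ₗ[R] X => g x) ht
  simp only [map_sum, LinearMap.coe_sum, Finset.sum_apply, dualTensorHom_apply,
    LinearMap.id_apply] at this
  rw [← Finset.sum_coe_sort] at this
  simpa [a, b, Fintype.linearCombination_apply] using this

theorem rTensor_injective_iff_of_exact {A B I C : Type u} [AddCommGroup A] [Module R A]
    [AddCommGroup B] [Module R B] [AddCommGroup I] [Module R I] [AddCommGroup C] [Module R C]
    {a : A →ₗ[R] B} {b : B →ₗ[R] I} (hab : Function.Exact a b) (hb : Function.Surjective b)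
    (c : I →ₗ[R] C) :
    Function.Injective (c.rTensor N) ↔
      ∀ s : B ⊗[R] N, (c ∘ₗ b).rTensor N s = 0 → ∃ u, a.rTensor N u = s := by
  have he := rTensor_exact N hab hb
  simp only [LinearMap.rTensor_comp, LinearMap.comp_apply]
  constructor
  · intro H s hs
    exact (he s).1 ((map_eq_zero_iff _ H).1 hs)
  · intro H
    rw [injective_iff_map_eq_zero]
    intro t ht
    obtain ⟨s, rfl⟩ := LinearMap.rTensor_surjective N hb t
    exact (he s).2 (H s ht)

/-- With `F₁ → F₀ → X → 0` a presentation by finite free modules, the module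
`coker (F₀* → F₁*)` has vanishing first `Tor` against `N` if and only if every
homomorphism `X → N` factors through a finite free module. -/
theorem torVanishes_transpose_iff {F₁ F₀ : Type u} [AddCommGroup F₁] [Module R F₁]
    [AddCommGroup F₀] [Module R F₀] [Module.Finite R F₁] [Module.Projective R F₁]
    [Module.Finite R F₀] [Module.Projective R F₀] {d : F₁ →ₗ[R] F₀} {p : F₀ →ₗ[R] X}
    (hdp : Function.Exact d p) (hp : Function.Surjective p) :
    TorVanishes R 1 N (Module.Dual R F₁ ⧸ LinearMap.range d.dualMap) ↔
      ∀ g : X →ₗ[R] N, g ∈ LinearMap.range (dualTensorHom R X N) := by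
  rw [torVanishes_one_iff (Submodule.subtype_injective _)
    (LinearMap.exact_subtype_mkQ (LinearMap.range d.dualMap)) (Submodule.mkQ_surjective _)]
  refine (lTensor_injective_iff_rTensor_injective _).trans ?_
  have hsurj : Function.Surjective d.dualMap.rangeRestrict :=
    LinearMap.surjective_rangeRestrict _
  have hex : Function.Exact p.dualMap d.dualMap.rangeRestrict := by
    intro φ
    constructor
    · intro h
      have h0 : φ ∘ₗ d = 0 := congrArg Subtype.val h
      obtain ⟨ψ, hψ⟩ := exists_comp_eq_of_exact hdp hp φ h0
      exact ⟨ψ, hψ⟩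
    · rintro ⟨ψ, rfl⟩
      ext x
      simp [hdp.apply_apply_eq_zero]
  have hb₁ := dualTensorHom_bijective (R := R) (M := F₁) (N := N)
  have hb₀ := dualTensorHom_bijective (R := R) (M := F₀) (N := N)
  -- Since `Fⱼ* ⊗ N ≅ Hom(Fⱼ, N)`, the kernel of `F₀* ⊗ N → F₁* ⊗ N` is `Hom(X, N)`; injectivity
  -- says that `X* ⊗ N` surjects onto it.
  refine (rTensor_injective_iff_of_exact (A := Module.Dual R X) (B := Module.Dual R F₀)
    (I := LinearMap.range d.dualMap) (C := Module.Dual R F₁) hex hsurj _).trans ?_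
  change (∀ s, d.dualMap.rTensor N s = 0 → ∃ u, p.dualMap.rTensor N u = s) ↔ _
  constructor
  · intro H g
    obtain ⟨s, hs⟩ := hb₀.2 (g ∘ₗ p)
    have h1 : d.dualMap.rTensor N s = 0 := by
      apply hb₁.1
      rw [dualTensorHom_rTensor_dualMap, hs, map_zero, LinearMap.comp_assoc,
        hdp.linearMap_comp_eq_zero, LinearMap.comp_zero]
    obtain ⟨u, rfl⟩ := H s h1
    refine ⟨u, ?_⟩
    rw [dualTensorHom_rTensor_dualMap] at hs
    exact (LinearMap.cancel_right hp).1 hs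
  · intro H s ht
    have h1 : dualTensorHom R F₀ N s ∘ₗ d = 0 := by
      rw [← dualTensorHom_rTensor_dualMap, ht, map_zero]
    obtain ⟨g, hg⟩ := exists_comp_eq_of_exact hdp hp _ h1
    obtain ⟨u, hu⟩ := H g
    refine ⟨u, hb₀.1 ?_⟩
    rw [dualTensorHom_rTensor_dualMap, hu, hg]

end DualTensor

/-! ### Splitting and freeness criteria over a local ring -/

section LocalRing

open TensorProduct IsLocalRing

variable {R : Type u} [CommRing R] [IsLocalRing R]

/-- By Nakayama one may pass to the residue field, where a tensor product of nonzero vector spaces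
is nonzero. -/
theorem subsingleton_of_subsingleton_tensorProduct {C N : Type u} [AddCommGroup C] [Module R C]
    [Module.Finite R C] [AddCommGroup N] [Module R N] [Module.Finite R N] [Nontrivial N]
    (h : Subsingleton (C ⊗[R] N)) : Subsingleton C := by
  by_contra hC
  rw [not_subsingleton_iff_nontrivial] at hC
  have h1 : Nontrivial (ResidueField R ⊗[R] C) := by
    rw [← not_subsingleton_iff_nontrivial, subsingleton_tensorProduct,
      not_subsingleton_iff_nontrivial]
    exact hC
  have h2 : Nontrivial (ResidueField R ⊗[R] N) := by
    rw [← not_subsingleton_iff_nontrivial, subsingleton_tensorProduct,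
      not_subsingleton_iff_nontrivial]
    assumption
  have h3 : Nontrivial ((ResidueField R ⊗[R] C) ⊗[ResidueField R] (ResidueField R ⊗[R] N)) :=
    inferInstance
  have h4 := (AlgebraTensorModule.distribBaseChange R (ResidueField R) C N).toEquiv.nontrivial
  have h5 : Subsingleton (ResidueField R ⊗[R] (C ⊗[R] N)) := inferInstance
  exact not_subsingleton_iff_nontrivial.2 h4 h5

/-- If every homomorphism from `K` to a nonzero finitely generated module `N` extends along
`i : K → F`, then `i` has a retraction. -/
theorem exists_retraction_of_forall_extend {K F N : Type u} [AddCommGroup K] [Module R K]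
    [Module.Finite R K] [Module.Projective R K] [AddCommGroup F] [Module R F]
    [Module.Finite R F] [Module.Projective R F] [AddCommGroup N] [Module R N]
    [Module.Finite R N] [Nontrivial N] (i : K →ₗ[R] F)
    (h : ∀ g : K →ₗ[R] N, ∃ g' : F →ₗ[R] N, g' ∘ₗ i = g) :
    ∃ r : F →ₗ[R] K, r ∘ₗ i = LinearMap.id := by
  have hKN := dualTensorHom_bijective (R := R) (M := K) (N := N)
  have hFN := dualTensorHom_bijective (R := R) (M := F) (N := N)
  have hsurj : Function.Surjective (i.dualMap.rTensor N) := by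
    intro t
    obtain ⟨g', hg'⟩ := h (dualTensorHom R K N t)
    obtain ⟨s, rfl⟩ := hFN.2 g'
    refine ⟨s, hKN.1 ?_⟩
    rw [dualTensorHom_rTensor_dualMap, hg']
  have hC : Subsingleton ((Module.Dual R K ⧸ LinearMap.range i.dualMap) ⊗[R] N) := by
    refine subsingleton_of_forall_eq 0 fun z => ?_
    obtain ⟨t, rfl⟩ := LinearMap.rTensor_surjective N
      (Submodule.mkQ_surjective (LinearMap.range i.dualMap)) z
    obtain ⟨s, rfl⟩ := hsurj t
    rw [← LinearMap.comp_apply, ← LinearMap.rTensor_comp, LinearMap.range_mkQ_comp,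
      LinearMap.rTensor_zero, LinearMap.zero_apply]
  have hC' := subsingleton_of_subsingleton_tensorProduct hC
  rw [Submodule.Quotient.subsingleton_iff, LinearMap.range_eq_top] at hC'
  -- As `F* → K*` is onto, so is `F* ⊗ K → K* ⊗ K`; a lift of the identity is the retraction.
  obtain ⟨t, ht⟩ := (dualTensorHom_bijective (R := R) (M := K) (N := K)).2 LinearMap.id
  obtain ⟨s, rfl⟩ := LinearMap.rTensor_surjective K hC' t
  exact ⟨dualTensorHom R F K s, by rw [← dualTensorHom_rTensor_dualMap, ht]⟩

theorem projective_of_retraction {K F T : Type u} [AddCommGroup K] [Module R K]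
    [Module.Finite R K] [AddCommGroup F] [Module R F] [Module.Finite R F] [Module.Free R F]
    [AddCommGroup T] [Module R T] {i : K →ₗ[R] F} {f : F →ₗ[R] T} (hif : Function.Exact i f)
    (hf : Function.Surjective f) (h : ∃ r : F →ₗ[R] K, r ∘ₗ i = LinearMap.id) :
    Module.Projective R T := by
  have := Module.free_of_lTensor_residueField_injective i f hf hif
    ((split_injective_iff_lTensor_residueField_injective i).1 h)
  infer_instance

variable [IsNoetherianRing R]

/-- Either the maximal ideal contains a nonzerodivisor on `N`, or the residue field embeds
into `N`. -/
theorem exists_isSMulRegular_or_residueField_embeds (N : Type u) [AddCommGroup N] [Module R N]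
    [Module.Finite R N] :
    (∃ x ∈ maximalIdeal R, IsSMulRegular N x) ∨
      ∃ j : ResidueField R →ₗ[R] N, Function.Injective j := by
  by_cases H : ∃ x ∈ maximalIdeal R, IsSMulRegular N x
  · exact Or.inl H
  right
  push Not at H
  have hfin := associatedPrimes.finite R N
  -- Prime avoidance: if the maximal ideal consists of zero divisors on `N`, it is an associated
  -- prime.
  have hsub : (maximalIdeal R : Set R) ⊆ ⋃ p ∈ (hfin.toFinset : Set (Ideal R)), (p : Set R) := by
    intro x hx
    rw [hfin.coe_toFinset, biUnion_associatedPrimes_eq_compl_regular]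
    exact H x hx
  obtain ⟨p, hp, hle⟩ := (Ideal.subset_union_prime (f := fun p : Ideal R => p) ⊥ ⊥
    (fun p hp _ _ => (hfin.mem_toFinset.1 hp).isPrime)).1 hsub
  have hp' := hfin.mem_toFinset.1 hp
  have heq : maximalIdeal R = p :=
    (maximalIdeal.isMaximal R).eq_of_le hp'.isPrime.ne_top hle
  obtain ⟨-, z, hz⟩ := isAssociatedPrime_iff.1 hp'
  rw [← heq] at hz
  have hker : LinearMap.ker (LinearMap.toSpanSingleton R N z) = maximalIdeal R := by
    rw [hz]
    ext r
    simp [Submodule.mem_colon_singleton]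
  exact ⟨(maximalIdeal R).liftQ (LinearMap.toSpanSingleton R N z) hker.ge,
    LinearMap.ker_eq_bot.1 (Submodule.ker_liftQ_eq_bot' _ _ hker.symm)⟩

/-- By induction the syzygy `K` is projective, so `k ⊗ K` embeds in `N ⊗ K`, which embeds in `N ⊗ F`
because `Tor₁(N, T) = 0`. Hence `k ⊗ K → k ⊗ F` is injective and `T` is free. -/
theorem projective_of_residueField_embeds {N : Type u} [AddCommGroup N] [Module R N]
    {j : ResidueField R →ₗ[R] N} (hj : Function.Injective j) (t : ℕ) :
    ∀ (T : Type u) [AddCommGroup T] [Module R T] [Module.Finite R T],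
      HasProjectiveDimensionLT (ModuleCat.of R T) (t + 1) → (∀ i, TorVanishes R (i + 1) N T) →
        Module.Projective R T := by
  induction t with
  | zero =>
    intro T _ _ _ h _
    exact projective_iff_hasProjectiveDimensionLT.2 h
  | succ t ih =>
    intro T _ _ _ h hT
    obtain ⟨F, _, _, _, _, f, hf⟩ := exists_finite_free_cover R T
    have hex := f.exact_subtype_ker_map
    have hi := Submodule.subtype_injective (LinearMap.ker f)
    have hK : Module.Projective R (LinearMap.ker f) :=
      ih _ ((hasProjectiveDimensionLT_ker_iff hf t).2 h)
        fun i => (torVanishes_succ_succ_iff hi hex hf i).1 (hT (i + 1))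
    have h1 := (hT 0).lTensor_injective hi hex hf
    have h2 : Function.Injective (j.rTensor (LinearMap.ker f)) :=
      Module.Flat.rTensor_preserves_injective_linearMap _ hj
    have h3 : (j.rTensor F) ∘ₗ (LinearMap.ker f).subtype.lTensor (ResidueField R) =
        (LinearMap.ker f).subtype.lTensor N ∘ₗ j.rTensor (LinearMap.ker f) := by
      rw [LinearMap.rTensor_comp_lTensor, LinearMap.lTensor_comp_rTensor]
    have h4 : Function.Injective ((LinearMap.ker f).subtype.lTensor (ResidueField R)) := by
      refine Function.Injective.of_comp (f := j.rTensor F) ?_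
      rw [← LinearMap.coe_comp, h3, LinearMap.coe_comp]
      exact h1.comp h2
    have := Module.free_of_lTensor_residueField_injective _ f hf hex h4
    infer_instance

end LocalRing

/-! ### Tor-independence modulo a regular element -/

section QuotSMulTop

open TensorProduct Pointwise

variable {R : Type u} [CommRing R] {N : Type u} [AddCommGroup N] [Module R N]

/-- The syzygy is needed: `x` is regular on `N ⊗ ker f` because this embeds in `N ⊗ F`, whereas it
may fail to be regular on `N ⊗ T`. Higher degrees reduce to degree one by further syzygies. -/
theorem torVanishes_quotSMulTop_ker {x : R} (hx : IsSMulRegular N x) (n : ℕ) :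
    ∀ {F T : Type u} [AddCommGroup F] [Module R F] [Module.Projective R F] [AddCommGroup T]
      [Module R T] {f : F →ₗ[R] T}, Function.Surjective f → (∀ i, TorVanishes R (i + 1) N T) →
        TorVanishes R (n + 1) (QuotSMulTop x N) (LinearMap.ker f) := by
  induction n with
  | zero =>
    intro F T _ _ _ _ _ f hf hT
    have hex := f.exact_subtype_ker_map
    have hi := Submodule.subtype_injective (LinearMap.ker f)
    obtain ⟨G, _, _, _, g, hg⟩ := exists_free_cover R (LinearMap.ker f)
    have hex' := g.exact_subtype_ker_map
    have hi' := Submodule.subtype_injective (LinearMap.ker g)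
    rw [torVanishes_one_iff hi' hex' hg]
    have hreg : IsSMulRegular (N ⊗[R] LinearMap.ker f) x := by
      have h1 : IsSMulRegular (N ⊗[R] F) x := hx.rTensor F
      exact h1.of_injective _ ((hT 0).lTensor_injective hi hex hf)
    have hexx : Function.Exact (LinearMap.lsmul R N x) (x • (⊤ : Submodule R N)).mkQ := by
      rw [LinearMap.exact_iff, Submodule.ker_mkQ]
      ext y
      simp [Submodule.mem_smul_pointwise_iff_exists]
    refine lTensor_injective_of_exact_of_exact_of_rTensor_injective hexx
      (Submodule.mkQ_surjective _) hex' hg ?_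
      (((torVanishes_succ_succ_iff hi hex hf 0).1 (hT 1)).lTensor_injective hi' hex' hg)
    have h2 : (LinearMap.lsmul R N x).rTensor (LinearMap.ker f) =
        LinearMap.lsmul R (N ⊗[R] LinearMap.ker f) x := by
      ext; simp [TensorProduct.smul_tmul']
    rw [h2]
    exact hreg
  | succ n ih =>
    intro F T _ _ _ _ _ f hf hT
    have hex := f.exact_subtype_ker_map
    have hi := Submodule.subtype_injective (LinearMap.ker f)
    obtain ⟨G, _, _, _, g, hg⟩ := exists_free_cover R (LinearMap.ker f)
    rw [torVanishes_succ_succ_iff (Submodule.subtype_injective _) g.exact_subtype_ker_map hg]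
    exact ih hg fun i => (torVanishes_succ_succ_iff hi hex hf i).1 (hT (i + 1))

end QuotSMulTop

/-! ### Bounding projective dimension by depth -/

section Depth

open IsLocalRing

variable {R : Type u} [CommRing R] [IsLocalRing R] [IsNoetherianRing R]

/-- If `T` has finite projective dimension greater than `n` and `Torᵢ(N, T) = 0` for all
`i ≥ 1`, then there is an `N`-regular sequence of length `n + 1`. -/
theorem exists_isWeaklyRegular_of_torVanishes (n : ℕ) :
    ∀ (N T : Type u) [AddCommGroup N] [Module R N] [Module.Finite R N] [Nontrivial N]
      [AddCommGroup T] [Module R T] [Module.Finite R T] (t : ℕ),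
      HasProjectiveDimensionLT (ModuleCat.of R T) (t + 1) →
      ¬ HasProjectiveDimensionLT (ModuleCat.of R T) (n + 1) →
      (∀ i, TorVanishes R (i + 1) N T) →
      ∃ rs : List R, (∀ r ∈ rs, r ∈ maximalIdeal R) ∧
        RingTheory.Sequence.IsWeaklyRegular N rs ∧ rs.length = n + 1 := by
  induction n with
  | zero =>
    intro N T _ _ _ _ _ _ _ t ht hn hT
    obtain ⟨x, hx, hreg⟩ | ⟨j, hj⟩ := exists_isSMulRegular_or_residueField_embeds (R := R) N
    · exact ⟨[x], by simpa using hx,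
        (RingTheory.Sequence.isWeaklyRegular_singleton_iff N x).2 hreg, rfl⟩
    · exact absurd (projective_iff_hasProjectiveDimensionLT.1
        (projective_of_residueField_embeds hj t T ht hT)) hn
  | succ n ih =>
    intro N T _ _ _ _ _ _ _ t ht hn hT
    obtain ⟨x, hx, hreg⟩ | ⟨j, hj⟩ := exists_isSMulRegular_or_residueField_embeds (R := R) N
    -- Replacing `N` by `N/xN` and `T` by its syzygy lowers both the projective dimension and the
    -- required length by one.
    · obtain ⟨F, _, _, _, _, f, hf⟩ := exists_finite_free_cover R T
      have : Nontrivial (QuotSMulTop x N) := nontrivial_quotSMulTop_of_mem_maximalIdeal N hx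
      obtain ⟨rs, hrs, hw, hl⟩ := ih (QuotSMulTop x N) (LinearMap.ker f) t
        ((hasProjectiveDimensionLT_ker_iff hf t).2
          (hasProjectiveDimensionLT_of_ge _ (t + 1) (t + 2) (by lia)))
        (fun h => hn ((hasProjectiveDimensionLT_ker_iff hf n).1 h))
        fun i => torVanishes_quotSMulTop_ker hreg i hf hT
      exact ⟨x :: rs, by simpa using ⟨hx, hrs⟩, hw.cons hreg, by simp [hl]⟩
    · have := projective_iff_hasProjectiveDimensionLT.1
        (projective_of_residueField_embeds hj t T ht hT)
      exact absurd (hasProjectiveDimensionLT_of_ge _ 1 (n + 1 + 1) (by lia)) hn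

theorem hasProjectiveDimensionLT_of_moduleDepth_le {N T : Type u} [AddCommGroup N] [Module R N]
    [Module.Finite R N] [Nontrivial N] [AddCommGroup T] [Module R T] [Module.Finite R T] {n : ℕ}
    (hT : projDim R T < ⊤) (hTor : ∀ i, TorVanishes R (i + 1) N T)
    (hn : moduleDepth R N ≤ n) : HasProjectiveDimensionLT (ModuleCat.of R T) (n + 1) := by
  by_contra h
  obtain ⟨t, ht⟩ := (projectiveDimension_ne_top_iff _).1 hT.ne
  obtain ⟨rs, hrs, hw, hl⟩ := exists_isWeaklyRegular_of_torVanishes n N T t ht h hTor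
  have h1 : ((rs.length : ℕ) : ℕ∞) ≤ moduleDepth R N :=
    le_iSup (fun rs : {rs : List R // (∀ r ∈ rs, r ∈ IsLocalRing.maximalIdeal R) ∧
      RingTheory.Sequence.IsWeaklyRegular N rs} => (rs.1.length : ℕ∞)) ⟨rs, hrs, hw⟩
  have h2 := h1.trans hn
  rw [hl] at h2
  have h3 : n + 1 ≤ n := by exact_mod_cast h2
  lia

end Depth

/-! ### Syzygies, Ext vanishing and the transpose argument -/

section Ext

variable {R : Type u} [CommRing R]

theorem subsingleton_ext_ker {F X N : Type u} [AddCommGroup F] [Module R F] [Module.Projective R F]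
    [AddCommGroup X] [Module R X] [AddCommGroup N] [Module R N] {f : F →ₗ[R] X}
    (hf : Function.Surjective f) (j : ℕ) (h : Subsingleton (ExtMod R (j + 2) X N)) :
    Subsingleton (ExtMod R (j + 1) (LinearMap.ker f) N) := by
  have : Projective (ModuleCat.of R F) := (IsProjective.iff_projective _).1 inferInstance
  refine subsingleton_of_forall_eq 0 fun x => ?_
  obtain ⟨y, rfl⟩ := Abelian.Ext.contravariant_sequence_exact₁
    (LinearMap.shortExact_shortComplexKer hf) (ModuleCat.of R N) x (n₁ := j + 2) (by lia)
    (Subsingleton.elim (α := ExtMod R (j + 2) X N) _ _)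
  rw [Abelian.Ext.eq_zero_of_projective y, Abelian.Ext.comp_zero]

theorem exists_extend_of_subsingleton_ext_one {F X N : Type u} [AddCommGroup F] [Module R F]
    [AddCommGroup X] [Module R X] [AddCommGroup N] [Module R N] {f : F →ₗ[R] X}
    (hf : Function.Surjective f) (h : Subsingleton (ExtMod R 1 X N))
    (g : LinearMap.ker f →ₗ[R] N) : ∃ g' : F →ₗ[R] N, g' ∘ₗ (LinearMap.ker f).subtype = g := by
  obtain ⟨y, hy⟩ := Abelian.Ext.contravariant_sequence_exact₁
    (LinearMap.shortExact_shortComplexKer hf) (ModuleCat.of R N)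
    (Abelian.Ext.mk₀ (ModuleCat.ofHom g)) (n₁ := 1) rfl
    (Subsingleton.elim (α := ExtMod R 1 X N) _ _)
  obtain ⟨y, rfl⟩ := (Abelian.Ext.mk₀_bijective _ _).2 y
  rw [Abelian.Ext.mk₀_comp_mk₀, (Abelian.Ext.mk₀_bijective _ _).1.eq_iff] at hy
  exact ⟨y.hom, congrArg ModuleCat.Hom.hom hy⟩

/-- Moving a syzygy across Tor: `Tor₁(ker f, T)` is controlled by `Tor₂(X, T)`, which shifts to
`Tor₁` of `X` with a syzygy of `T`, of smaller projective dimension. -/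
theorem torVanishes_ker_of_hasProjectiveDimensionLT {F X : Type u} [AddCommGroup F] [Module R F]
    [Module.Projective R F] [AddCommGroup X] [Module R X] {f : F →ₗ[R] X}
    (hf : Function.Surjective f) {n : ℕ}
    (hX : ∀ (T : Type u) [AddCommGroup T] [Module R T],
      HasProjectiveDimensionLT (ModuleCat.of R T) (n + 1) → TorVanishes R 1 X T)
    (T : Type u) [AddCommGroup T] [Module R T]
    (hT : HasProjectiveDimensionLT (ModuleCat.of R T) (n + 2)) :
    TorVanishes R 1 (LinearMap.ker f) T := by
  obtain ⟨G, _, _, _, g, hg⟩ := exists_free_cover R T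
  refine TorVanishes.syzygy_left ?_ (Submodule.subtype_injective _) f.exact_subtype_ker_map hf
  rw [torVanishes_succ_succ_iff (Submodule.subtype_injective _) g.exact_subtype_ker_map hg]
  exact hX _ ((hasProjectiveDimensionLT_ker_iff hg n).2 hT)

theorem exists_syzygy [IsNoetherianRing R] (n : ℕ) (M : Type u) [AddCommGroup M] [Module R M]
    [Module.Finite R M] :
    ∃ (X : Type u) (_ : AddCommGroup X) (_ : Module R X), Module.Finite R X ∧
      (∀ (T : Type u) [AddCommGroup T] [Module R T],
        HasProjectiveDimensionLT (ModuleCat.of R T) (n + 1) → TorVanishes R 1 X T) ∧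
      (∀ j, HasProjectiveDimensionLT (ModuleCat.of R X) (j + 1) ↔
        HasProjectiveDimensionLT (ModuleCat.of R M) (n + j + 1)) ∧
      ∀ (N : Type u) [AddCommGroup N] [Module R N] (j : ℕ),
        Subsingleton (ExtMod R (n + j + 1) M N) → Subsingleton (ExtMod R (j + 1) X N) := by
  induction n with
  | zero =>
    refine ⟨M, _, _, inferInstance, fun T _ _ hT => ?_, fun j => ?_, fun N _ _ j h => ?_⟩
    · have := projective_iff_hasProjectiveDimensionLT.2 hT
      exact torVanishes_of_projective 0
    · rw [zero_add]
    · rwa [zero_add] at h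
  | succ n ih =>
    obtain ⟨X, _, _, _, hTor, hpd, hExt⟩ := ih
    obtain ⟨F, _, _, _, _, f, hf⟩ := exists_finite_free_cover R X
    refine ⟨LinearMap.ker f, inferInstance, inferInstance, inferInstance,
      torVanishes_ker_of_hasProjectiveDimensionLT hf hTor, fun j => ?_, fun N _ _ j h => ?_⟩
    · rw [hasProjectiveDimensionLT_ker_iff hf, hpd (j + 1),
        show n + 1 + j + 1 = n + (j + 1) + 1 by lia]
    · rw [show n + 1 + j + 1 = n + (j + 1) + 1 by lia] at h
      exact subsingleton_ext_ker hf j (hExt N (j + 1) h)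

theorem exists_syzygy_of_subsingleton_ext [IsNoetherianRing R] [IsLocalRing R]
    {M N : Type u} [AddCommGroup M] [Module R M] [Module.Finite R M]
    [AddCommGroup N] [Module R N] {n : ℕ} (h : Subsingleton (ExtMod R n M N)) :
    ∃ (X F : Type u) (_ : AddCommGroup X) (_ : Module R X) (_ : AddCommGroup F) (_ : Module R F)
      (i : X →ₗ[R] F), Module.Finite R X ∧ Module.Finite R F ∧ Module.Free R F ∧
      (∀ g : X →ₗ[R] N, ∃ g' : F →ₗ[R] N, g' ∘ₗ i = g) ∧
      (∀ (T : Type u) [AddCommGroup T] [Module R T],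
        HasProjectiveDimensionLT (ModuleCat.of R T) (n + 1) → TorVanishes R 1 X T) ∧
      (HasProjectiveDimensionLT (ModuleCat.of R M) (n + 1) → Module.Projective R X) ∧
      ((∃ r : F →ₗ[R] X, r ∘ₗ i = LinearMap.id) →
        HasProjectiveDimensionLT (ModuleCat.of R M) n) := by
  cases n with
  | zero =>
    -- Here `Hom(M, N) = 0`, so zero extends every map; a retraction through the zero module forces
    -- `M = 0`, that is, `pd M < 0`.
    refine ⟨M, Fin 0 → R, _, _, inferInstance, inferInstance, 0, inferInstance, inferInstance,
      inferInstance, fun g => ⟨0, ?_⟩, fun T _ _ hT => ?_,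
      projective_iff_hasProjectiveDimensionLT.2, fun ⟨r, hr⟩ => ?_⟩
    · have : ModuleCat.ofHom (0 : M →ₗ[R] N) = ModuleCat.ofHom g :=
        (Abelian.Ext.mk₀_bijective _ _).1 (Subsingleton.elim (α := ExtMod R 0 M N) _ _)
      exact congrArg ModuleCat.Hom.hom this
    · have := projective_iff_hasProjectiveDimensionLT.2 hT
      exact torVanishes_of_projective 0
    · have : Subsingleton M := subsingleton_of_forall_eq 0 fun x => by
        have := LinearMap.congr_fun hr x
        simpa using this.symm
      exact (ModuleCat.isZero_of_subsingleton (ModuleCat.of R M)).hasProjectiveDimensionLT_zero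
  | succ n =>
    obtain ⟨X, _, _, _, hTor, hpd, hExt⟩ := exists_syzygy (R := R) n M
    obtain ⟨F, _, _, _, _, f, hf⟩ := exists_finite_free_cover R X
    refine ⟨LinearMap.ker f, F, inferInstance, inferInstance, _, _, (LinearMap.ker f).subtype,
      inferInstance, inferInstance, inferInstance,
      exists_extend_of_subsingleton_ext_one hf (hExt N 0 h),
      torVanishes_ker_of_hasProjectiveDimensionLT hf hTor, fun hM => ?_, fun hr => ?_⟩
    · rw [projective_iff_hasProjectiveDimensionLT]
      exact (hasProjectiveDimensionLT_ker_iff hf 0).2 ((hpd 1).2 hM)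
    · exact (hpd 0).1 (projective_iff_hasProjectiveDimensionLT.1
        (projective_of_retraction f.exact_subtype_ker_map hf hr))

/-- If `Extⁿ(M, N) = 0` and `pd M ≤ n`, with `N` nonzero, then `pd M < n`. -/
theorem hasProjectiveDimensionLT_of_subsingleton_ext [IsNoetherianRing R] [IsLocalRing R]
    {M N : Type u} [AddCommGroup M] [Module R M] [Module.Finite R M]
    [AddCommGroup N] [Module R N] [Module.Finite R N] [Nontrivial N] {n : ℕ}
    (h : Subsingleton (ExtMod R n M N))
    (hM : HasProjectiveDimensionLT (ModuleCat.of R M) (n + 1)) :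
    HasProjectiveDimensionLT (ModuleCat.of R M) n := by
  obtain ⟨X, F, _, _, _, _, i, _, _, _, hext, -, hproj, hsplit⟩ :=
    exists_syzygy_of_subsingleton_ext h
  have := hproj hM
  exact hsplit (exists_retraction_of_forall_extend i hext)

/-- If `Extⁿ(M, N) = 0`, `N` is nonzero and every finitely generated `T` with `Tor₁(N, T) = 0`
has projective dimension at most `n`, then `pd M < n`. -/
theorem hasProjectiveDimensionLT_of_torVanishes_imp [IsNoetherianRing R] [IsLocalRing R]
    {M N : Type u} [AddCommGroup M] [Module R M] [Module.Finite R M]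
    [AddCommGroup N] [Module R N] [Module.Finite R N] [Nontrivial N] {n : ℕ}
    (h : Subsingleton (ExtMod R n M N))
    (hN : ∀ (T : Type u) [AddCommGroup T] [Module R T] [Module.Finite R T],
      TorVanishes R 1 N T → HasProjectiveDimensionLT (ModuleCat.of R T) (n + 1)) :
    HasProjectiveDimensionLT (ModuleCat.of R M) n := by
  obtain ⟨X, F, _, _, _, _, i, _, _, _, hext, hTor, -, hsplit⟩ :=
    exists_syzygy_of_subsingleton_ext h
  obtain ⟨F₀, _, _, _, _, p, hp⟩ := exists_finite_free_cover R X
  obtain ⟨F₁, _, _, _, _, q, hq⟩ := exists_finite_free_cover R (LinearMap.ker p)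
  have hex : Function.Exact ((LinearMap.ker p).subtype ∘ₗ q) p := by
    rw [LinearMap.exact_iff, LinearMap.range_comp, LinearMap.range_eq_top.2 hq,
      Submodule.map_top, Submodule.range_subtype]
  have h1 := (torVanishes_transpose_iff (N := N) hex hp).2 fun g => by
    obtain ⟨g', rfl⟩ := hext g
    exact mem_range_dualTensorHom_of_factor i g'
  -- `h1` and `hN` bound the projective dimension of the transpose, so `Tor₁(X, -)` kills it; the
  -- criterion is reused for maps `X → X`.
  have := projective_of_id_mem_range_dualTensorHom
    ((torVanishes_transpose_iff (N := X) hex hp).1 (hTor _ (hN _ h1)) LinearMap.id)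
  exact hsplit (exists_retraction_of_forall_extend i hext)

/-- Ext vanishes above `pd M`; were it zero in degree `pd M`, the splitting argument would lower `pd
M`. -/
theorem supExt_eq_projDim [IsNoetherianRing R] [IsLocalRing R]
    {M N : Type u} [AddCommGroup M] [Module R M] [Module.Finite R M]
    [AddCommGroup N] [Module R N] [Module.Finite R N] [Nontrivial N] [Nontrivial M] {n : ℕ}
    (hM : HasProjectiveDimensionLT (ModuleCat.of R M) n) :
    projDim R M = supExt R M N := by
  classical
  have hex : ∃ n, HasProjectiveDimensionLT (ModuleCat.of R M) n := ⟨n, hM⟩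
  obtain ⟨m, hm⟩ : ∃ m, Nat.find hex = m := ⟨_, rfl⟩
  have hm1 : HasProjectiveDimensionLT (ModuleCat.of R M) m := hm ▸ Nat.find_spec hex
  have hm2 : ∀ k < m, ¬ HasProjectiveDimensionLT (ModuleCat.of R M) k :=
    fun k hk => Nat.find_min hex (hm ▸ hk)
  cases m with
  | zero =>
    have := isZero_of_hasProjectiveDimensionLT_zero (ModuleCat.of R M)
    rw [ModuleCat.isZero_iff_subsingleton] at this
    exact absurd this (not_subsingleton_iff_nontrivial.2 ‹_›)
  | succ m =>
    have hp : projDim R M = ((m : ℕ∞) : WithBot ℕ∞) :=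
      le_antisymm ((projectiveDimension_le_iff _ m).2 hm1)
        ((projectiveDimension_ge_iff _ m).2 (hm2 m (Nat.lt_succ_self m)))
    rw [hp, supExt]
    refine le_antisymm (le_sSup ⟨m, rfl, ?_⟩) (sSup_le ?_)
    · rw [← not_subsingleton_iff_nontrivial]
      exact fun h => hm2 m (Nat.lt_succ_self m) (hasProjectiveDimensionLT_of_subsingleton_ext h hm1)
    · rintro _ ⟨k, rfl, hk⟩
      rw [← not_subsingleton_iff_nontrivial] at hk
      have : k ≤ m := by
        by_contra hlt
        exact hk (HasProjectiveDimensionLT.subsingleton (ModuleCat.of R M) (m + 1) k (by lia)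
          (ModuleCat.of R N))
      exact_mod_cast this

end Ext

/-! ### The main theorem -/

theorem mainTheorem2 {R : Type u} [CommRing R] [IsNoetherianRing R] [IsLocalRing R]
    {M N : Type u} [AddCommGroup M] [Module R M] [Module.Finite R M] [Nontrivial M]
    [AddCommGroup N] [Module R N] [Module.Finite R N] [Nontrivial N]
    (n : ℕ) (hExt : Subsingleton (ExtMod R n M N))
    (hN : (IsStronglyRigid R N ∧ moduleDepth R R ≤ (n : ℕ∞)) ∨
      (IsRigidTest R N ∧ moduleDepth R N ≤ (n : ℕ∞))) :
    projDim R M = supExt R M N ∧ projDim R M + 1 ≤ ((n : ℕ∞) : WithBot ℕ∞) := by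
  have hM : HasProjectiveDimensionLT (ModuleCat.of R M) n := by
    refine hasProjectiveDimensionLT_of_torVanishes_imp hExt fun T _ _ _ hT => ?_
    obtain ⟨hN, hn⟩ | ⟨hN, hn⟩ := hN
    -- `R` is flat, hence Tor-independent of `T`, so the bound by `depth R` applies.
    · exact hasProjectiveDimensionLT_of_moduleDepth_le (N := R) (hN T 1 le_rfl hT)
        (fun i => torVanishes_of_flat i) hn
    · refine hasProjectiveDimensionLT_of_moduleDepth_le (N := N) (hN T 1 le_rfl hT).2
        (fun i => ?_) hn
      -- Rigidity propagates the vanishing from degree one to all higher degrees.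
      induction i with
      | zero => exact hT
      | succ i ih => exact (hN T (i + 1) (by lia) ih).1
  refine ⟨supExt_eq_projDim hM, ?_⟩
  have h := projectiveDimension_lt_iff.2 hM
  exact ENat.WithBot.add_one_le_natCast_iff.2 h
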